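/- Let $n \ge 1$, let $\Omega \subset \mathbb{R}^n$ be a bounded domain (non-empty, open, connected), let $p \ge 2$ and let $\alpha$ be a real number with $2n < \alpha p < n + p$. Put $s = \alpha - n/p \in (0,1)$. For a measurable function $u$ on $\mathbb{R}^n$ with $0<\int_{\mathbb{R}^n}|u|^p\,dx<\infty$ let $$ R(u) = \frac{\displaystyle\int_{\mathbb{R}^n}\!\int_{\mathbb{R}^n} \frac{|u(y)-u(x)|^p}{|y-x|^{\alpha p}}\,dx\,dy}{\displaystyle\int_{\mathbb{R}^n}|u(x)|^p\,dx} \in [0,\infty], \qquad \lambda_1 = \inf\{R(\phi) : \phi \in C_0^\infty(\Omega),\ \phi \not\equiv 0\}. $$ Here $C_0^\infty(\Omega)$ is the set of smooth functions with compact support contained in $\Omega$. Let $W_0^{s,p}(\Omega)$ be the closure of $C_0^\infty(\Omega)$ in the norm given by $$\|u\|_{W^{s,p}(\Omega)}^p = \int_\Omega\!\int_\Omega \frac{|u(y)-u(x)|^p}{|y-x|^{sp+n}}\,dx\,dy + \int_\Omega |u|^p\,dx,$$ its elements being extended by zero to $\mathbb{R}^n$ and identified when they agree almost everywhere. A minimizer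 of the Rayleigh quotient is a function $u \in W_0^{s,p}(\Omega)$, $u \not\equiv 0$, with $R(u) = \lambda_1$. Theorem. The minimizer of the Rayleigh quotient is unique, except that it may be multiplied by a constant: if $u$ is a minimizer, then a function $v$ is a minimizer if and only if there is a real constant $c \neq 0$ with $v = c\,u$ almost everywhere in $\mathbb{R}^n$. -/

import Mathlib

open MeasureTheory Filter Topology
open scoped ENNReal

noncomputable section

namespace FractionalRayleigh

/-- The double integral `∫_D ∫_D |u(y) - u(x)|^p / |y - x|^β dy dx`, with values in `[0, ∞]`. -/
def gagliardoEnergy {n : ℕ} (p β : ℝ) (D : Set (EuclideanSpace ℝ (Fin n)))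
    (u : EuclideanSpace ℝ (Fin n) → ℝ) : ℝ≥0∞ :=
  ∫⁻ x in D, ∫⁻ y in D, ENNReal.ofReal (|u y - u x| ^ p / ‖y - x‖ ^ β)

/-- The integral `∫_D |u|^p dx`, with values in `[0, ∞]`. -/
def powIntegral {n : ℕ} (p : ℝ) (D : Set (EuclideanSpace ℝ (Fin n)))
    (u : EuclideanSpace ℝ (Fin n) → ℝ) : ℝ≥0∞ :=
  ∫⁻ x in D, ENNReal.ofReal (|u x| ^ p)

/-- The `p`-th power of the norm of `W^{s,p}(D)`. -/
def sobolevNormPow {n : ℕ} (s p : ℝ) (D : Set (EuclideanSpace ℝ (Fin n)))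
    (u : EuclideanSpace ℝ (Fin n) → ℝ) : ℝ≥0∞ :=
  gagliardoEnergy p (s * p + n) D u + powIntegral p D u

/-- The class `C_0^∞(D)`: smooth functions with compact support contained in `D`. -/
def IsTestFunction {n : ℕ} (D : Set (EuclideanSpace ℝ (Fin n)))
    (φ : EuclideanSpace ℝ (Fin n) → ℝ) : Prop :=
  ContDiff ℝ ((⊤ : ℕ∞) : WithTop ℕ∞) φ ∧ HasCompactSupport φ ∧ tsupport φ ⊆ D

/-- `u ∈ W_0^{s,p}(D)`, the closure of `C_0^∞(D)` in the norm of `W^{s,p}(D)`; its elements are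
regarded as functions (up to null sets) on the whole space, extended by zero outside `D`. -/
def MemW0 {n : ℕ} (s p : ℝ) (D : Set (EuclideanSpace ℝ (Fin n)))
    (u : EuclideanSpace ℝ (Fin n) → ℝ) : Prop :=
  AEStronglyMeasurable u volume ∧ sobolevNormPow s p D u < ∞ ∧
    (∀ᵐ x ∂(volume : Measure (EuclideanSpace ℝ (Fin n))), x ∉ D → u x = 0) ∧
    ∃ φ : ℕ → EuclideanSpace ℝ (Fin n) → ℝ, (∀ k, IsTestFunction D (φ k)) ∧
      Tendsto (fun k => sobolevNormPow s p D (fun x => φ k x - u x)) atTop (𝓝 0)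

/-- The fractional Rayleigh quotient; both integrals are over the whole space. -/
def rayleigh {n : ℕ} (α p : ℝ) (u : EuclideanSpace ℝ (Fin n) → ℝ) : ℝ≥0∞ :=
  gagliardoEnergy p (α * p) Set.univ u / powIntegral p Set.univ u

/-- The first eigenvalue `λ₁(Ω)`: the infimum of the Rayleigh quotient over the functions in
`C_0^∞(Ω)` that do not vanish identically. -/
def firstEigenvalue {n : ℕ} (α p : ℝ) (Ω : Set (EuclideanSpace ℝ (Fin n))) : ℝ≥0∞ :=
  sInf {r | ∃ φ : EuclideanSpace ℝ (Fin n) → ℝ, IsTestFunction Ω φ ∧ φ ≠ 0 ∧ rayleigh α p φ = r}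

/-- `u` is a minimizer of the Rayleigh quotient: a nonzero element of `W_0^{s,p}(Ω)`,
`s = α - n/p`, whose Rayleigh quotient equals `λ₁(Ω)`. -/
def IsMinimizer {n : ℕ} (α p : ℝ) (Ω : Set (EuclideanSpace ℝ (Fin n)))
    (u : EuclideanSpace ℝ (Fin n) → ℝ) : Prop :=
  MemW0 (α - n / p) p Ω u ∧ ¬ (u =ᵐ[volume] fun _ => 0) ∧
    rayleigh α p u = firstEigenvalue α p Ω

end FractionalRayleigh

end

noncomputable section

namespace FractionalRayleigh

/-! Given minimizers u, v, compare with w = (|u|^p + |v|^p)^(1/p). Its p-th power integral is the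
sum of those of u and v. The reverse triangle inequality in ℓ^p on pairs gives |w(y) - w(x)|^p ≤
|u(y) - u(x)|^p + |v(y) - v(x)|^p, so E(w) ≤ E(u) + E(v) = λ₁ ∫ w^p, with E the whole-space energy.
If λ₁ ∫ w^p ≤ E(w) as well, the pointwise inequality is an equality for almost every pair (x, y). By
strict convexity this forces u(x) v(y) = u(y) v(x), and fixing x with u(x) ≠ 0 yields v = c u. No
sign information on u or v is needed (`exists_ae_eq_const_mul`).

The technical point is λ₁ ∫ w^p ≤ E(w) (`mul_powIntegral_pairNorm_le`): λ₁ is an infimum over test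
functions, and the closure norm sees only Ω × Ω, so convergence in it does not by itself control the
interaction of Ω with its complement. With test functions φ_k → u, ψ_k → v, set g_k = min(w,
(|φ_k|^p + |ψ_k|^p)^(1/p)). Each g_k is bounded with support in a compact subset of Ω, and
mollification, which does not raise the energy, gives the inequality for it
(`mul_powIntegral_le_of_isCompact`). Off Ω × Ω the differences of g_k are bounded by those of w; on
Ω × Ω they are dominated along a subsequence with summable errors. Dominated convergence for E and
Fatou for the power integral finish the argument. -/

/-! ### Minkowski's inequality for pairs and its equality case -/

/-- The `ℓ^p` norm of the pair `(a, b)`. -/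
def pairNorm (p a b : ℝ) : ℝ := (|a| ^ p + |b| ^ p) ^ (1 / p)

lemma pairNorm_nonneg (p a b : ℝ) : 0 ≤ pairNorm p a b := by
  unfold pairNorm; positivity

lemma pairNorm_rpow {p : ℝ} (hp : 0 < p) (a b : ℝ) :
    pairNorm p a b ^ p = |a| ^ p + |b| ^ p := by
  unfold pairNorm
  rw [← Real.rpow_mul (by positivity), one_div_mul_cancel hp.ne', Real.rpow_one]

lemma pairNorm_neg (p a b : ℝ) : pairNorm p (-a) (-b) = pairNorm p a b := by
  simp [pairNorm]

lemma eq_zero_of_pairNorm_eq_zero {p : ℝ} (hp : 0 < p) {a b : ℝ} (h : pairNorm p a b = 0) :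
    a = 0 ∧ b = 0 := by
  have h1 := pairNorm_rpow hp a b
  rw [h, Real.zero_rpow hp.ne'] at h1
  have ha : 0 ≤ |a| ^ p := by positivity
  have hb : 0 ≤ |b| ^ p := by positivity
  have ha' : |a| ^ p = 0 := by linarith
  have hb' : |b| ^ p = 0 := by linarith
  rw [Real.rpow_eq_zero (abs_nonneg _) hp.ne', abs_eq_zero] at ha' hb'
  exact ⟨ha', hb'⟩

@[simp] lemma pairNorm_zero {p : ℝ} (hp : 0 < p) : pairNorm p 0 0 = 0 := by
  simp [pairNorm, Real.zero_rpow hp.ne', hp.ne']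

lemma continuous_pairNorm {p : ℝ} (hp : 0 < p) :
    Continuous fun z : ℝ × ℝ => pairNorm p z.1 z.2 := by
  unfold pairNorm
  refine Continuous.rpow_const ?_ fun _ => Or.inr (by positivity)
  exact (continuous_fst.abs.rpow_const fun _ => Or.inr hp.le).add
    (continuous_snd.abs.rpow_const fun _ => Or.inr hp.le)

/-- Strict convexity of `t ↦ |t| ^ p`. -/
lemma abs_rpow_convex_comb {p : ℝ} (hp : 1 < p) {s t : ℝ} (hs : 0 < s) (ht : 0 < t)
    (hst : s + t = 1) (x y : ℝ) :
    |s * x + t * y| ^ p ≤ s * |x| ^ p + t * |y| ^ p ∧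
      (|s * x + t * y| ^ p = s * |x| ^ p + t * |y| ^ p → x = y) := by
  have hp0 : 0 < p := by linarith
  have htri : |s * x + t * y| ≤ s * |x| + t * |y| := by
    refine (abs_add_le _ _).trans_eq ?_
    rw [abs_mul, abs_mul, abs_of_pos hs, abs_of_pos ht]
  have h1 : |s * x + t * y| ^ p ≤ (s * |x| + t * |y|) ^ p :=
    Real.rpow_le_rpow (abs_nonneg _) htri hp0.le
  have h2 : (s * |x| + t * |y|) ^ p ≤ s * |x| ^ p + t * |y| ^ p :=
    (strictConvexOn_rpow hp).convexOn.2 (abs_nonneg x) (abs_nonneg y) hs.le ht.le hst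
  refine ⟨h1.trans h2, fun h => ?_⟩
  have hxy : |x| = |y| := by
    by_contra hne
    have h3 : (s * |x| + t * |y|) ^ p < s * |x| ^ p + t * |y| ^ p :=
      (strictConvexOn_rpow hp).2 (abs_nonneg x) (abs_nonneg y) hne hs ht hst
    linarith
  have h4 : |s * x + t * y| = s * |x| + t * |y| := by
    by_contra hne
    have := Real.rpow_lt_rpow (abs_nonneg _) (lt_of_le_of_ne htri hne) hp0
    linarith
  rcases abs_eq_abs.1 hxy with h5 | h5
  · exact h5
  -- Opposite signs: equality in the triangle inequality would give |t - s| = 1 unless y = 0,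
  -- impossible for positive weights of sum 1.
  · subst h5
    rw [abs_neg, ← add_mul, hst, one_mul, ← abs_neg y] at h4
    have h6 : s * -y + t * y = (t - s) * y := by ring
    rw [h6, abs_mul, abs_neg] at h4
    by_cases hy : y = 0
    · simp [hy]
    · have hy' : |y| ≠ 0 := by simpa using hy
      have h7 : |t - s| = 1 := by
        field_simp at h4
        exact h4
      rcases abs_eq (zero_le_one) |>.1 h7 with h8 | h8 <;> linarith

/-- Minkowski's inequality for pairs, with the case of equality. -/
lemma pairNorm_add_le {p : ℝ} (hp : 1 < p) (b₁ b₂ c₁ c₂ : ℝ) :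
    pairNorm p (b₁ + c₁) (b₂ + c₂) ≤ pairNorm p b₁ b₂ + pairNorm p c₁ c₂ ∧
      (pairNorm p (b₁ + c₁) (b₂ + c₂) = pairNorm p b₁ b₂ + pairNorm p c₁ c₂ →
        b₁ * c₂ = b₂ * c₁) := by
  have hp0 : 0 < p := by linarith
  rcases (pairNorm_nonneg p b₁ b₂).eq_or_lt with hB | hB
  · obtain ⟨rfl, rfl⟩ := eq_zero_of_pairNorm_eq_zero hp0 hB.symm
    simp [pairNorm_zero hp0]
  rcases (pairNorm_nonneg p c₁ c₂).eq_or_lt with hC | hC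
  · obtain ⟨rfl, rfl⟩ := eq_zero_of_pairNorm_eq_zero hp0 hC.symm
    simp [pairNorm_zero hp0]
  set A := pairNorm p (b₁ + c₁) (b₂ + c₂) with hA
  have hA0 : 0 ≤ A := pairNorm_nonneg _ _ _
  have hAp : A ^ p = |b₁ + c₁| ^ p + |b₂ + c₂| ^ p := pairNorm_rpow hp0 _ _
  have hBp := pairNorm_rpow hp0 b₁ b₂
  have hCp := pairNorm_rpow hp0 c₁ c₂
  set B := pairNorm p b₁ b₂ with hBdef
  set C := pairNorm p c₁ c₂ with hCdef
  have hBC : 0 < B + C := by linarith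
  -- The normalized pairs b/B and c/C lie on the unit sphere, and (b + c)/(B + C) is their convex
  -- combination with these weights; convexity is then applied in each coordinate.
  have hs : 0 < B / (B + C) := by positivity
  have ht : 0 < C / (B + C) := by positivity
  have hst : B / (B + C) + C / (B + C) = 1 := by field_simp
  have key1 := abs_rpow_convex_comb hp hs ht hst (b₁ / B) (c₁ / C)
  have key2 := abs_rpow_convex_comb hp hs ht hst (b₂ / B) (c₂ / C)
  have e1 : B / (B + C) * (b₁ / B) + C / (B + C) * (c₁ / C) = (b₁ + c₁) / (B + C) := by
    field_simp
  have e2 : B / (B + C) * (b₂ / B) + C / (B + C) * (c₂ / C) = (b₂ + c₂) / (B + C) := by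
    field_simp
  rw [e1] at key1
  rw [e2] at key2
  have hdiv : ∀ x r : ℝ, 0 < r → |x / r| ^ p = |x| ^ p / r ^ p := fun x r hr => by
    rw [abs_div, abs_of_pos hr, Real.div_rpow (abs_nonneg _) hr.le]
  have hBp0 : 0 < B ^ p := by positivity
  have hCp0 : 0 < C ^ p := by positivity
  have hBCp0 : 0 < (B + C) ^ p := by positivity
  have sX : |b₁ / B| ^ p + |b₂ / B| ^ p = 1 := by
    rw [hdiv _ _ hB, hdiv _ _ hB, ← add_div, ← hBp, div_self hBp0.ne']
  have sY : |c₁ / C| ^ p + |c₂ / C| ^ p = 1 := by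
    rw [hdiv _ _ hC, hdiv _ _ hC, ← add_div, ← hCp, div_self hCp0.ne']
  have sA : |(b₁ + c₁) / (B + C)| ^ p + |(b₂ + c₂) / (B + C)| ^ p = A ^ p / (B + C) ^ p := by
    rw [hdiv _ _ hBC, hdiv _ _ hBC, ← add_div, ← hAp]
  set s := B / (B + C)
  set t := C / (B + C)
  have hsum : s * |b₁ / B| ^ p + t * |c₁ / C| ^ p + (s * |b₂ / B| ^ p + t * |c₂ / C| ^ p) = 1 := by
    linear_combination s * sX + t * sY + hst
  constructor
  · have : A ^ p / (B + C) ^ p ≤ 1 := by linarith [key1.1, key2.1]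
    rw [div_le_one hBCp0] at this
    exact (Real.rpow_le_rpow_iff hA0 hBC.le hp0).1 this
  · intro h
    rw [h, div_self hBCp0.ne'] at sA
    have h1 := key1.2 (by linarith [key1.1, key2.1])
    have h2 := key2.2 (by linarith [key1.1, key2.1])
    have h3 : b₁ = B * (c₁ / C) := by rw [← h1]; field_simp
    have h4 : b₂ = B * (c₂ / C) := by rw [← h2]; field_simp
    rw [h3, h4]; ring

lemma abs_pairNorm_sub_le {p : ℝ} (hp : 1 < p) (a₁ a₂ b₁ b₂ : ℝ) :
    |pairNorm p a₁ a₂ - pairNorm p b₁ b₂| ≤ pairNorm p (a₁ - b₁) (a₂ - b₂) := by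
  have h1 := (pairNorm_add_le hp b₁ b₂ (a₁ - b₁) (a₂ - b₂)).1
  have h2 := (pairNorm_add_le hp a₁ a₂ (b₁ - a₁) (b₂ - a₂)).1
  rw [← neg_sub a₁, ← neg_sub a₂, pairNorm_neg] at h2
  simp only [add_sub_cancel, neg_sub] at h1 h2
  rw [abs_le]
  constructor <;> linarith

lemma abs_pairNorm_sub_rpow_le {p : ℝ} (hp : 1 < p) (a₁ a₂ b₁ b₂ : ℝ) :
    |pairNorm p a₁ a₂ - pairNorm p b₁ b₂| ^ p ≤ |a₁ - b₁| ^ p + |a₂ - b₂| ^ p := by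
  rw [← pairNorm_rpow (by linarith)]
  exact Real.rpow_le_rpow (abs_nonneg _) (abs_pairNorm_sub_le hp _ _ _ _) (by linarith)

/-- Equality here is equality in Minkowski for b + (a - b) or for a + (b - a), according to the sign
of the difference of norms; proportionality of the summands makes a and b proportional. -/
lemma mul_eq_mul_of_abs_pairNorm_sub_rpow_eq {p : ℝ} (hp : 1 < p) {a₁ a₂ b₁ b₂ : ℝ}
    (h : |pairNorm p a₁ a₂ - pairNorm p b₁ b₂| ^ p = |a₁ - b₁| ^ p + |a₂ - b₂| ^ p) :
    a₁ * b₂ = b₁ * a₂ := by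
  have hp0 : 0 < p := by linarith
  rw [← pairNorm_rpow hp0, Real.rpow_left_inj (abs_nonneg _) (pairNorm_nonneg _ _ _) hp0.ne'] at h
  rcases abs_choice (pairNorm p a₁ a₂ - pairNorm p b₁ b₂) with h1 | h1
  · have := (pairNorm_add_le hp b₁ b₂ (a₁ - b₁) (a₂ - b₂)).2
      (by simp only [add_sub_cancel]; linarith)
    linarith
  · rw [← pairNorm_neg p (a₁ - b₁), neg_sub, neg_sub] at h
    have := (pairNorm_add_le hp a₁ a₂ (b₁ - a₁) (b₂ - a₂)).2
      (by simp only [add_sub_cancel]; linarith)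
    linarith

/-! ### Invariance under null-set changes and scaling -/

variable {n : ℕ}

lemma gagliardoEnergy_congr {p β : ℝ} {D : Set (EuclideanSpace ℝ (Fin n))}
    {u v : EuclideanSpace ℝ (Fin n) → ℝ} (h : u =ᵐ[volume] v) :
    gagliardoEnergy p β D u = gagliardoEnergy p β D v := by
  have h' : u =ᵐ[volume.restrict D] v := ae_restrict_of_ae h
  refine lintegral_congr_ae ?_
  filter_upwards [h'] with x hx
  refine lintegral_congr_ae ?_
  filter_upwards [h'] with y hy
  rw [hx, hy]

lemma powIntegral_congr {p : ℝ} {D : Set (EuclideanSpace ℝ (Fin n))}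
    {u v : EuclideanSpace ℝ (Fin n) → ℝ} (h : u =ᵐ[volume] v) :
    powIntegral p D u = powIntegral p D v := by
  refine lintegral_congr_ae ?_
  filter_upwards [ae_restrict_of_ae h] with x hx
  rw [hx]

lemma sobolevNormPow_congr {s p : ℝ} {D : Set (EuclideanSpace ℝ (Fin n))}
    {u v : EuclideanSpace ℝ (Fin n) → ℝ} (h : u =ᵐ[volume] v) :
    sobolevNormPow s p D u = sobolevNormPow s p D v := by
  rw [sobolevNormPow, sobolevNormPow, gagliardoEnergy_congr h, powIntegral_congr h]

lemma gagliardoEnergy_const_mul {p β : ℝ} {D : Set (EuclideanSpace ℝ (Fin n))}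
    (c : ℝ) (u : EuclideanSpace ℝ (Fin n) → ℝ) :
    gagliardoEnergy p β D (fun x => c * u x) =
      ENNReal.ofReal (|c| ^ p) * gagliardoEnergy p β D u := by
  unfold gagliardoEnergy
  rw [← lintegral_const_mul' _ _ ENNReal.ofReal_ne_top]
  refine lintegral_congr fun x => ?_
  rw [← lintegral_const_mul' _ _ ENNReal.ofReal_ne_top]
  refine lintegral_congr fun y => ?_
  rw [← ENNReal.ofReal_mul (by positivity), ← mul_sub, abs_mul,
    Real.mul_rpow (abs_nonneg _) (abs_nonneg _), mul_div_assoc]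

lemma powIntegral_const_mul {p : ℝ} {D : Set (EuclideanSpace ℝ (Fin n))}
    (c : ℝ) (u : EuclideanSpace ℝ (Fin n) → ℝ) :
    powIntegral p D (fun x => c * u x) = ENNReal.ofReal (|c| ^ p) * powIntegral p D u := by
  unfold powIntegral
  rw [← lintegral_const_mul' _ _ ENNReal.ofReal_ne_top]
  refine lintegral_congr fun x => ?_
  rw [← ENNReal.ofReal_mul (by positivity), abs_mul,
    Real.mul_rpow (abs_nonneg _) (abs_nonneg _)]

lemma sobolevNormPow_const_mul {s p : ℝ} {D : Set (EuclideanSpace ℝ (Fin n))}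
    (c : ℝ) (u : EuclideanSpace ℝ (Fin n) → ℝ) :
    sobolevNormPow s p D (fun x => c * u x) =
      ENNReal.ofReal (|c| ^ p) * sobolevNormPow s p D u := by
  rw [sobolevNormPow, sobolevNormPow, gagliardoEnergy_const_mul, powIntegral_const_mul, mul_add]

lemma IsTestFunction.const_mul {D : Set (EuclideanSpace ℝ (Fin n))}
    {φ : EuclideanSpace ℝ (Fin n) → ℝ} (h : IsTestFunction D φ) (c : ℝ) :
    IsTestFunction D fun x => c * φ x :=
  ⟨contDiff_const.mul h.1, h.2.1.mul_left, (tsupport_mul_subset_right).trans h.2.2⟩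

lemma MemW0.congr {s p : ℝ} {D : Set (EuclideanSpace ℝ (Fin n))}
    {u v : EuclideanSpace ℝ (Fin n) → ℝ} (hu : MemW0 s p D u) (h : u =ᵐ[volume] v) :
    MemW0 s p D v := by
  obtain ⟨h1, h2, h3, φ, h4, h5⟩ := hu
  refine ⟨h1.congr h, sobolevNormPow_congr h ▸ h2, ?_, φ, h4, ?_⟩
  · filter_upwards [h, h3] with x hx hx' hxD
    rw [← hx, hx' hxD]
  · convert h5 using 2 with k
    refine sobolevNormPow_congr ?_
    filter_upwards [h] with x hx
    rw [hx]

lemma MemW0.const_mul {s p : ℝ} {D : Set (EuclideanSpace ℝ (Fin n))}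
    {u : EuclideanSpace ℝ (Fin n) → ℝ} (hu : MemW0 s p D u) (c : ℝ) :
    MemW0 s p D fun x => c * u x := by
  obtain ⟨h1, h2, h3, φ, h4, h5⟩ := hu
  refine ⟨h1.const_mul c, ?_, ?_, fun k x => c * φ k x, fun k => (h4 k).const_mul c, ?_⟩
  · rw [sobolevNormPow_const_mul]
    exact ENNReal.mul_lt_top ENNReal.ofReal_lt_top h2
  · filter_upwards [h3] with x hx hxD
    rw [hx hxD, mul_zero]
  · simp_rw [← mul_sub, sobolevNormPow_const_mul]
    simpa using ENNReal.Tendsto.const_mul (a := ENNReal.ofReal (|c| ^ p)) h5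
      (Or.inr ENNReal.ofReal_ne_top)

lemma IsMinimizer.congr {α p : ℝ} {D : Set (EuclideanSpace ℝ (Fin n))}
    {u v : EuclideanSpace ℝ (Fin n) → ℝ} (hu : IsMinimizer α p D u) (h : u =ᵐ[volume] v) :
    IsMinimizer α p D v := by
  refine ⟨hu.1.congr h, fun hv => hu.2.1 (h.trans hv), ?_⟩
  rw [← hu.2.2, rayleigh, rayleigh, gagliardoEnergy_congr h, powIntegral_congr h]

lemma IsMinimizer.const_mul {α p : ℝ} {D : Set (EuclideanSpace ℝ (Fin n))}
    {u : EuclideanSpace ℝ (Fin n) → ℝ} (hu : IsMinimizer α p D u) {c : ℝ} (hc : c ≠ 0) :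
    IsMinimizer α p D fun x => c * u x := by
  refine ⟨hu.1.const_mul c, fun hv => hu.2.1 ?_, ?_⟩
  · filter_upwards [hv] with x hx
    simpa [hc] using hx
  · rw [← hu.2.2, rayleigh, rayleigh, gagliardoEnergy_const_mul, powIntegral_const_mul]
    refine ENNReal.mul_div_mul_left _ _ ?_ ENNReal.ofReal_ne_top
    have : 0 < |c| ^ p := Real.rpow_pos_of_pos (abs_pos.2 hc) p
    simpa using this

/-! ### The energy on the product space; basic facts on minimizers -/

/-- The singular kernel `‖z‖ ^ (-β)`. -/
def kernel (β : ℝ) (z : EuclideanSpace ℝ (Fin n)) : ℝ≥0∞ := ENNReal.ofReal (‖z‖ ^ β)⁻¹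

/-- The integrand `|u(y) - u(x)| ^ p / ‖y - x‖ ^ β` of the Gagliardo energy. -/
def diffQuot (p β : ℝ) (u : EuclideanSpace ℝ (Fin n) → ℝ)
    (z : EuclideanSpace ℝ (Fin n) × EuclideanSpace ℝ (Fin n)) : ℝ≥0∞ :=
  ENNReal.ofReal (|u z.2 - u z.1| ^ p) * kernel β (z.2 - z.1)

lemma measurable_kernel (β : ℝ) :
    Measurable (kernel β : EuclideanSpace ℝ (Fin n) → ℝ≥0∞) := by
  unfold kernel; fun_prop

lemma kernel_ne_top (β : ℝ) (z : EuclideanSpace ℝ (Fin n)) : kernel β z ≠ ∞ :=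
  ENNReal.ofReal_ne_top

lemma ofReal_diff_div (p β : ℝ) (u : EuclideanSpace ℝ (Fin n) → ℝ)
    (x y : EuclideanSpace ℝ (Fin n)) :
    ENNReal.ofReal (|u y - u x| ^ p / ‖y - x‖ ^ β) = diffQuot p β u (x, y) := by
  rw [diffQuot, kernel, div_eq_mul_inv, ENNReal.ofReal_mul (by positivity)]

lemma measurable_diffQuot {p β : ℝ} {u : EuclideanSpace ℝ (Fin n) → ℝ} (hu : Measurable u) :
    Measurable (diffQuot p β u) := by
  unfold diffQuot
  exact (by fun_prop : Measurable fun z : EuclideanSpace ℝ (Fin n) × EuclideanSpace ℝ (Fin n) =>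
    ENNReal.ofReal (|u z.2 - u z.1| ^ p)).mul
    ((measurable_kernel β).comp (measurable_snd.sub measurable_fst))

lemma gagliardoEnergy_eq_lintegral_prod {p β : ℝ} (D : Set (EuclideanSpace ℝ (Fin n)))
    {u : EuclideanSpace ℝ (Fin n) → ℝ} (hu : Measurable u) :
    gagliardoEnergy p β D u = ∫⁻ z in D ×ˢ D, diffQuot p β u z ∂(volume.prod volume) := by
  rw [← Measure.prod_restrict, lintegral_prod _ (measurable_diffQuot hu).aemeasurable]
  simp_rw [gagliardoEnergy, ofReal_diff_div]

lemma gagliardoEnergy_univ_eq {p β : ℝ}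
    {u : EuclideanSpace ℝ (Fin n) → ℝ} (hu : Measurable u) :
    gagliardoEnergy p β Set.univ u = ∫⁻ z, diffQuot p β u z ∂(volume.prod volume) := by
  rw [gagliardoEnergy_eq_lintegral_prod _ hu, Set.univ_prod_univ, Measure.restrict_univ]

lemma powIntegral_univ_eq {p : ℝ} (hp : 0 < p) {D : Set (EuclideanSpace ℝ (Fin n))}
    (hD : MeasurableSet D) {u : EuclideanSpace ℝ (Fin n) → ℝ}
    (hu : ∀ᵐ x ∂(volume : Measure (EuclideanSpace ℝ (Fin n))), x ∉ D → u x = 0) :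
    powIntegral p Set.univ u = powIntegral p D u := by
  unfold powIntegral
  rw [Measure.restrict_univ, ← lintegral_indicator hD]
  refine lintegral_congr_ae ?_
  filter_upwards [hu] with x hx
  by_cases h : x ∈ D
  · simp [h]
  · simp [h, hx h, Real.zero_rpow hp.ne']

lemma powIntegral_ne_zero {p : ℝ} (hp : 0 < p)
    {u : EuclideanSpace ℝ (Fin n) → ℝ} (hm : AEMeasurable u volume)
    (hu : ¬ u =ᵐ[volume] fun _ => 0) : powIntegral p Set.univ u ≠ 0 := by
  intro h
  apply hu
  unfold powIntegral at h
  rw [Measure.restrict_univ, lintegral_eq_zero_iff' (by fun_prop)] at h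
  filter_upwards [h] with x hx
  simp only [Pi.zero_apply, ENNReal.ofReal_eq_zero] at hx
  have : |u x| ^ p = 0 := le_antisymm hx (by positivity)
  rwa [Real.rpow_eq_zero (abs_nonneg _) hp.ne', abs_eq_zero] at this

lemma MemW0.powIntegral_ne_top {s p : ℝ} (hp : 0 < p) {D : Set (EuclideanSpace ℝ (Fin n))}
    (hD : MeasurableSet D) {u : EuclideanSpace ℝ (Fin n) → ℝ} (hu : MemW0 s p D u) :
    powIntegral p Set.univ u ≠ ∞ := by
  rw [powIntegral_univ_eq hp hD hu.2.2.1]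
  exact (le_add_self.trans_lt hu.2.1).ne

lemma IsMinimizer.gagliardoEnergy_eq {α p : ℝ} (hp : 0 < p) {D : Set (EuclideanSpace ℝ (Fin n))}
    (hD : MeasurableSet D) {u : EuclideanSpace ℝ (Fin n) → ℝ} (hu : IsMinimizer α p D u) :
    gagliardoEnergy p (α * p) Set.univ u = firstEigenvalue α p D * powIntegral p Set.univ u := by
  rw [← hu.2.2, rayleigh, ENNReal.div_mul_cancel
    (powIntegral_ne_zero hp hu.1.1.aemeasurable hu.2.1) (hu.1.powIntegral_ne_top hp hD)]

/-- A representative vanishing everywhere off `D` allows pointwise, rather than almost everywhere,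
comparisons in the later estimates. -/
lemma IsMinimizer.exists_measurable {α p : ℝ} {D : Set (EuclideanSpace ℝ (Fin n))}
    (hD : MeasurableSet D) {u : EuclideanSpace ℝ (Fin n) → ℝ} (hu : IsMinimizer α p D u) :
    ∃ v, Measurable v ∧ (∀ x ∉ D, v x = 0) ∧ u =ᵐ[volume] v ∧ IsMinimizer α p D v := by
  have h : u =ᵐ[volume] D.indicator (hu.1.1.mk u) := by
    filter_upwards [hu.1.1.ae_eq_mk, hu.1.2.2.1] with x hx hx'
    by_cases h : x ∈ D
    · simp [h, hx]
    · simp [h, hx' h]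
  exact ⟨_, hu.1.1.stronglyMeasurable_mk.measurable.indicator hD,
    fun x hx => Set.indicator_of_notMem hx _, h, hu.congr h⟩

lemma IsTestFunction.mul_powIntegral_le {α p : ℝ} (hp : 0 < p)
    {D : Set (EuclideanSpace ℝ (Fin n))} {φ : EuclideanSpace ℝ (Fin n) → ℝ}
    (h : IsTestFunction D φ) :
    firstEigenvalue α p D * powIntegral p Set.univ φ ≤ gagliardoEnergy p (α * p) Set.univ φ := by
  by_cases hφ : φ = 0
  · simp [hφ, powIntegral, Real.zero_rpow hp.ne']
  · have : firstEigenvalue α p D ≤ rayleigh α p φ := sInf_le ⟨φ, h, hφ, rfl⟩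
    calc _ ≤ rayleigh α p φ * powIntegral p Set.univ φ := by gcongr
      _ ≤ _ := by rw [mul_comm]; exact ENNReal.mul_div_le

/-! ### Finiteness of test-function energies and of the first eigenvalue -/

/-- In polar coordinates, β < n + p gives integrability at the origin and β > n at infinity. -/
lemma lintegral_norm_rpow_lt_top (hn : 1 ≤ n) {p β : ℝ} (h1 : (n : ℝ) < β) (h2 : β < n + p) :
    ∫⁻ z : EuclideanSpace ℝ (Fin n),
      ENNReal.ofReal (if ‖z‖ ≤ 1 then ‖z‖ ^ (p - β) else ‖z‖ ^ (-β)) < ∞ := by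
  have : Nonempty (Fin n) := ⟨⟨0, hn⟩⟩
  refine Integrable.lintegral_lt_top ?_
  rw [integrable_fun_norm_addHaar volume
    (f := fun r : ℝ => if r ≤ 1 then r ^ (p - β) else r ^ (-β)), finrank_euclideanSpace_fin]
  have hcast : ((n - 1 : ℕ) : ℝ) = n - 1 := by push_cast [hn]; ring
  rw [← Set.Ioc_union_Ioi_eq_Ioi zero_le_one]
  refine IntegrableOn.union ?_ ?_
  · have h := (intervalIntegral.intervalIntegrable_rpow' (a := 0) (b := 1)
      (r := n - 1 + (p - β)) (by linarith))
    rw [intervalIntegrable_iff_integrableOn_Ioc_of_le zero_le_one] at h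
    refine h.congr_fun (fun r hr => ?_) measurableSet_Ioc
    simp only [hr.2, if_true, smul_eq_mul]
    rw [Real.rpow_add hr.1, ← hcast, Real.rpow_natCast]
  · have h := integrableOn_Ioi_rpow_of_lt (a := n - 1 + -β) (c := 1) (by linarith) one_pos
    refine h.congr_fun (fun r hr => ?_) measurableSet_Ioi
    have hr0 : (0 : ℝ) < r := lt_trans one_pos hr
    simp only [not_le.2 (Set.mem_Ioi.1 hr), if_false, smul_eq_mul]
    rw [Real.rpow_add hr0, ← hcast, Real.rpow_natCast]

lemma IsTestFunction.gagliardoEnergy_lt_top (hn : 1 ≤ n) {p β : ℝ} (hp : 0 < p)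
    (h1 : (n : ℝ) < β) (h2 : β < n + p)
    {D : Set (EuclideanSpace ℝ (Fin n))} {φ : EuclideanSpace ℝ (Fin n) → ℝ}
    (h : IsTestFunction D φ) : gagliardoEnergy p β Set.univ φ < ∞ := by
  obtain ⟨hs, hc, -⟩ := h
  obtain ⟨A, hA⟩ := hs.lipschitzWith_of_hasCompactSupport hc (by simp)
  obtain ⟨M, hM⟩ := hs.continuous.bounded_above_of_compact_support hc
  have hM0 : 0 ≤ M := (norm_nonneg _).trans (hM 0)
  -- The Lipschitz bound serves for ‖y - x‖ ≤ 1, the sup bound beyond.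
  set C : ℝ := max ((A : ℝ) ^ p) ((2 * M) ^ p) with hC
  have hC0 : 0 ≤ C := le_max_of_le_left (by positivity)
  set f : EuclideanSpace ℝ (Fin n) → ℝ≥0∞ := fun z =>
    ENNReal.ofReal (if ‖z‖ ≤ 1 then ‖z‖ ^ (p - β) else ‖z‖ ^ (-β)) with hf
  have hfm : Measurable f := by
    refine ENNReal.measurable_ofReal.comp (Measurable.ite ?_ (by fun_prop) (by fun_prop))
    exact measurableSet_le measurable_norm measurable_const
  have hfi : ∫⁻ z, f z < ∞ := lintegral_norm_rpow_lt_top hn h1 h2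
  set K := tsupport φ with hK
  have hKm : MeasurableSet K := (isClosed_tsupport φ).measurableSet
  have hKv : volume K < ∞ := IsCompact.measure_lt_top hc
  set i : EuclideanSpace ℝ (Fin n) → ℝ≥0∞ := K.indicator 1 with hi
  have him : Measurable i := measurable_one.indicator hKm
  have hfmin : ∀ x y, ENNReal.ofReal (|φ y - φ x| ^ p / ‖y - x‖ ^ β) ≤
      ENNReal.ofReal C * f (y - x) := by
    intro x y
    rw [hf, ← ENNReal.ofReal_mul hC0]
    refine ENNReal.ofReal_le_ofReal ?_
    rcases eq_or_ne y x with rfl | hxy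
    · rw [sub_self, abs_zero, Real.zero_rpow hp.ne', zero_div]
      split_ifs <;> positivity
    have hr : 0 < ‖y - x‖ := norm_pos_iff.2 (sub_ne_zero.2 hxy)
    split_ifs with hr1
    · have : |φ y - φ x| ^ p ≤ (A * ‖y - x‖) ^ p := by
        refine Real.rpow_le_rpow (abs_nonneg _) ?_ hp.le
        simpa [dist_eq_norm] using hA.dist_le_mul y x
      rw [Real.mul_rpow (NNReal.coe_nonneg A) hr.le] at this
      rw [Real.rpow_sub hr, ← mul_div_assoc]
      gcongr
      exact this.trans (by gcongr; exact le_max_left _ _)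
    · have : |φ y - φ x| ^ p ≤ (2 * M) ^ p := by
        refine Real.rpow_le_rpow (abs_nonneg _) ?_ hp.le
        have := norm_sub_le (φ y) (φ x)
        rw [Real.norm_eq_abs] at this
        linarith [hM y, hM x]
      rw [Real.rpow_neg hr.le, ← div_eq_mul_inv]
      gcongr
      exact this.trans (le_max_right _ _)
  -- The integrand vanishes unless x or y lies in the support, which has finite measure; this makes
  -- the double integral of a function of y - x finite.
  have hbound : ∀ x y, ENNReal.ofReal (|φ y - φ x| ^ p / ‖y - x‖ ^ β) ≤
      i x * (ENNReal.ofReal C * f (y - x)) + i y * (ENNReal.ofReal C * f (y - x)) := by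
    intro x y
    by_cases hx : x ∈ K
    · refine le_add_right ?_
      simpa [hi, hx] using hfmin x y
    by_cases hy : y ∈ K
    · refine le_add_left ?_
      simpa [hi, hy] using hfmin x y
    · simp [image_eq_zero_of_notMem_tsupport hx, image_eq_zero_of_notMem_tsupport hy,
        Real.zero_rpow hp.ne']
  have hii : ∫⁻ x, i x = volume K := lintegral_indicator_one hKm
  have m1 : Measurable fun z : EuclideanSpace ℝ (Fin n) × EuclideanSpace ℝ (Fin n) =>
      ENNReal.ofReal C * f (z.2 - z.1) :=
    (hfm.comp (measurable_snd.sub measurable_fst)).const_mul _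
  unfold gagliardoEnergy
  simp only [Measure.restrict_univ]
  calc _ ≤ ∫⁻ x, ∫⁻ y, (i x * (ENNReal.ofReal C * f (y - x))
        + i y * (ENNReal.ofReal C * f (y - x))) := by
        gcongr with x y; exact hbound x y
    _ = (∫⁻ x, ∫⁻ y, i x * (ENNReal.ofReal C * f (y - x)))
        + ∫⁻ x, ∫⁻ y, i y * (ENNReal.ofReal C * f (y - x)) := by
        rw [← lintegral_add_left]
        · refine lintegral_congr fun x => lintegral_add_left ?_ _
          exact (m1.comp measurable_prodMk_left).const_mul _
        · exact (Measurable.mul (him.comp measurable_fst) m1).lintegral_prod_right'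
    _ = volume K * (ENNReal.ofReal C * ∫⁻ z, f z)
        + volume K * (ENNReal.ofReal C * ∫⁻ z, f z) := by
        congr 1
        · rw [← hii, ← lintegral_mul_const _ him]
          refine lintegral_congr fun x => ?_
          have hfx : Measurable fun y => f (y - x) := hfm.comp (measurable_id.sub_const x)
          rw [lintegral_const_mul _ (hfx.const_mul _), lintegral_const_mul _ hfx,
            lintegral_sub_right_eq_self f x]
        · rw [lintegral_lintegral_swap
            (Measurable.mul (him.comp measurable_snd) m1).aemeasurable,
            ← hii, ← lintegral_mul_const _ him]
          refine lintegral_congr fun y => ?_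
          have hfy : Measurable fun x => f (y - x) := hfm.comp (measurable_id.const_sub y)
          rw [lintegral_const_mul _ (hfy.const_mul _), lintegral_const_mul _ hfy,
            lintegral_sub_left_eq_self f y]
    _ < ∞ := by finiteness

lemma firstEigenvalue_lt_top (hn : 1 ≤ n) {α p : ℝ} (hp : 0 < p)
    (h1 : (n : ℝ) < α * p) (h2 : α * p < n + p)
    {D : Set (EuclideanSpace ℝ (Fin n))} (hD : IsOpen D) (hne : D.Nonempty) :
    firstEigenvalue α p D < ∞ := by
  obtain ⟨x, hx⟩ := hne
  obtain ⟨φ, hφ1, hφ2, hφ3, -, hφ5⟩ :=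
    exists_contDiff_tsupport_subset (n := (⊤ : ℕ∞)) (hD.mem_nhds hx)
  have ht : IsTestFunction D φ := ⟨hφ3, hφ2, hφ1⟩
  have hne : φ ≠ 0 := fun h => by simp [h] at hφ5
  refine (sInf_le ⟨φ, ht, hne, rfl⟩ : firstEigenvalue α p D ≤ _).trans_lt ?_
  refine ENNReal.div_lt_top (ht.gagliardoEnergy_lt_top hn hp h1 h2).ne ?_
  refine powIntegral_ne_zero hp hφ3.continuous.aemeasurable fun h => hne ?_
  exact (Continuous.ae_eq_iff_eq volume hφ3.continuous continuous_const).1 h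

/-! ### Mollification and the Rayleigh inequality for compact support -/

lemma ofReal_abs_rpow {p : ℝ} (hp : 0 ≤ p) (a : ℝ) : ENNReal.ofReal (|a| ^ p) = ‖a‖ₑ ^ p := by
  rw [Real.enorm_eq_ofReal_abs, ENNReal.ofReal_rpow_of_nonneg (abs_nonneg _) hp]

/-- Jensen's inequality for averages with respect to a probability density. -/
lemma ofReal_abs_integral_mul_rpow_le {X : Type*} [MeasurableSpace X] {μ : Measure X} {p : ℝ}
    (hp : 1 ≤ p) {η d : X → ℝ} (hη : Measurable η) (hη0 : ∀ t, 0 ≤ η t)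
    (hη1 : ∫⁻ t, ENNReal.ofReal (η t) ∂μ = 1) (hd : Measurable d) :
    ENNReal.ofReal (|∫ t, η t * d t ∂μ| ^ p) ≤
      ∫⁻ t, ENNReal.ofReal (η t) * ENNReal.ofReal (|d t| ^ p) ∂μ := by
  have hp0 : 0 < p := by linarith
  -- With η as a probability density, the claim is monotonicity of L^q norms from q = 1 to q = p.
  set ν := μ.withDensity fun t => ENNReal.ofReal (η t) with hν
  have : IsProbabilityMeasure ν := ⟨by simp [hν, hη1]⟩
  have hηm : Measurable fun t => ENNReal.ofReal (η t) := hη.ennreal_ofReal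
  have h1 : ‖∫ t, η t * d t ∂μ‖ₑ ≤ eLpNorm' d 1 ν := by
    refine (enorm_integral_le_lintegral_enorm _).trans_eq ?_
    rw [eLpNorm'_eq_lintegral_enorm, hν]
    simp only [ENNReal.rpow_one, div_one]
    rw [lintegral_withDensity_eq_lintegral_mul _ hηm hd.enorm]
    refine lintegral_congr fun t => ?_
    rw [enorm_mul, Real.enorm_of_nonneg (hη0 t)]
    rfl
  have h2 : eLpNorm' d 1 ν ≤ eLpNorm' d p ν :=
    eLpNorm'_le_eLpNorm'_of_exponent_le one_pos hp ν hd.aestronglyMeasurable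
  rw [ofReal_abs_rpow hp0.le]
  calc _ ≤ (eLpNorm' d p ν) ^ p := by gcongr; exact h1.trans h2
    _ = ∫⁻ t, ‖d t‖ₑ ^ p ∂ν := by
        rw [eLpNorm'_eq_lintegral_enorm, ← ENNReal.rpow_mul, one_div_mul_cancel hp0.ne',
          ENNReal.rpow_one]
    _ = _ := by
        rw [hν, lintegral_withDensity_eq_lintegral_mul _ hηm (by fun_prop)]
        refine lintegral_congr fun t => ?_
        rw [ofReal_abs_rpow hp0.le]
        rfl

/-- Mollification does not increase the Gagliardo energy. -/
lemma gagliardoEnergy_convolution_le {p β : ℝ} (hp : 1 ≤ p)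
    {η g : EuclideanSpace ℝ (Fin n) → ℝ} (hη : Continuous η) (hηc : HasCompactSupport η)
    (hη0 : ∀ t, 0 ≤ η t) (hη1 : ∫⁻ t, ENNReal.ofReal (η t) = 1)
    (hg : Measurable g) (hgi : LocallyIntegrable g volume) :
    gagliardoEnergy p β Set.univ (convolution η g (ContinuousLinearMap.lsmul ℝ ℝ) volume) ≤
      gagliardoEnergy p β Set.univ g := by
  set h := convolution η g (ContinuousLinearMap.lsmul ℝ ℝ) volume with hh
  have hex : ConvolutionExists η g (ContinuousLinearMap.lsmul ℝ ℝ) volume :=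
    hηc.convolutionExists_left _ hη hgi
  have hηm : Measurable fun t => ENNReal.ofReal (η t) := hη.measurable.ennreal_ofReal
  have hdiff : ∀ x y, h y - h x = ∫ t, η t * (g (y - t) - g (x - t)) := by
    intro x y
    rw [hh, convolution, convolution, ← integral_sub (hex y) (hex x)]
    refine integral_congr_ae (Eventually.of_forall fun t => ?_)
    simp [mul_sub]
  -- Shifting x and y by the same t leaves the kernel unchanged, so Jensen passes through it;
  -- Tonelli and translation invariance then remove t.
  have hle : ∀ x y, ENNReal.ofReal (|h y - h x| ^ p / ‖y - x‖ ^ β) ≤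
      ∫⁻ t, ENNReal.ofReal (η t) * diffQuot p β g (x - t, y - t) := by
    intro x y
    rw [ofReal_diff_div, diffQuot]
    simp only [diffQuot, sub_sub_sub_cancel_right, ← mul_assoc]
    rw [lintegral_mul_const' _ _ (kernel_ne_top _ _), hdiff]
    gcongr
    exact ofReal_abs_integral_mul_rpow_le hp hη.measurable hη0 hη1 (by fun_prop)
  have m3 : Measurable fun q : (EuclideanSpace ℝ (Fin n) × EuclideanSpace ℝ (Fin n)) ×
      EuclideanSpace ℝ (Fin n) =>
      ENNReal.ofReal (η q.2) * diffQuot p β g (q.1.1 - q.2, q.1.2 - q.2) :=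
    (hηm.comp measurable_snd).mul ((measurable_diffQuot hg).comp (by fun_prop))
  calc gagliardoEnergy p β Set.univ h
      ≤ ∫⁻ x, ∫⁻ y, ∫⁻ t, ENNReal.ofReal (η t) * diffQuot p β g (x - t, y - t) := by
        unfold gagliardoEnergy
        simp only [Measure.restrict_univ]
        gcongr with x y
        exact hle x y
    _ = ∫⁻ t, ENNReal.ofReal (η t) * gagliardoEnergy p β Set.univ g := by
        have e1 : ∀ x : EuclideanSpace ℝ (Fin n),
            ∫⁻ y, ∫⁻ t, ENNReal.ofReal (η t) * diffQuot p β g (x - t, y - t) =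
            ∫⁻ t, ENNReal.ofReal (η t) * ∫⁻ y, diffQuot p β g (x - t, y) := fun x => by
          rw [lintegral_lintegral_swap]
          · refine lintegral_congr fun t => ?_
            rw [lintegral_const_mul' _ _ ENNReal.ofReal_ne_top,
              lintegral_sub_right_eq_self (fun y => diffQuot p β g (x - t, y)) t]
          · exact (m3.comp (f := fun q : _ × _ => ((x, q.1), q.2)) (by fun_prop)).aemeasurable
        simp_rw [e1]
        have mI : Measurable fun x => ∫⁻ y, diffQuot p β g (x, y) :=
          (measurable_diffQuot hg).lintegral_prod_right'
        rw [lintegral_lintegral_swap]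
        · refine lintegral_congr fun t => ?_
          rw [lintegral_const_mul' _ _ ENNReal.ofReal_ne_top,
            lintegral_sub_right_eq_self (fun x => ∫⁻ y, diffQuot p β g (x, y)) t]
          simp only [gagliardoEnergy, Measure.restrict_univ, ofReal_diff_div]
        · exact ((hηm.comp measurable_snd).mul (mI.comp (by fun_prop :
            Measurable fun q : EuclideanSpace ℝ (Fin n) × EuclideanSpace ℝ (Fin n) =>
              q.1 - q.2))).aemeasurable
    _ = gagliardoEnergy p β Set.univ g := by
        rw [lintegral_mul_const _ hηm, hη1, one_mul]

lemma lintegral_ofReal_normed {c : EuclideanSpace ℝ (Fin n)} (f : ContDiffBump c) :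
    ∫⁻ t, ENNReal.ofReal (f.normed volume t) = 1 := by
  rw [← ofReal_integral_eq_lintegral_ofReal f.integrable_normed
    (Eventually.of_forall f.nonneg_normed), f.integral_normed, ENNReal.ofReal_one]

lemma IsTestFunction.convolution_normed {D K : Set (EuclideanSpace ℝ (Fin n))}
    (hK : IsCompact K) {g : EuclideanSpace ℝ (Fin n) → ℝ} (hg : LocallyIntegrable g volume)
    (hgK : ∀ x ∉ K, g x = 0) (f : ContDiffBump (0 : EuclideanSpace ℝ (Fin n)))
    (hf : Metric.cthickening f.rOut K ⊆ D) :
    IsTestFunction D (convolution (f.normed volume) g (ContinuousLinearMap.lsmul ℝ ℝ) volume) := by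
  have hsub : tsupport (convolution (f.normed volume) g (ContinuousLinearMap.lsmul ℝ ℝ) volume) ⊆
      Metric.cthickening f.rOut K := by
    refine closure_minimal ?_ Metric.isClosed_cthickening
    refine (support_convolution_subset _).trans ?_
    rintro _ ⟨a, ha, b, hb, rfl⟩
    rw [f.support_normed_eq, mem_ball_zero_iff] at ha
    refine Metric.mem_cthickening_of_dist_le _ b _ _ ?_ (by simpa using ha.le)
    by_contra h
    exact hb (hgK b h)
  refine ⟨?_, ?_, hsub.trans hf⟩
  · exact f.hasCompactSupport_normed.contDiff_convolution_left _ f.contDiff_normed hg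
  · exact hK.cthickening.of_isClosed_subset (isClosed_tsupport _) hsub

/-- The Rayleigh inequality for bounded functions supported in a compact subset of `D`. -/
lemma mul_powIntegral_le_of_isCompact {α p : ℝ} (hp : 1 ≤ p)
    {D K : Set (EuclideanSpace ℝ (Fin n))} (hD : IsOpen D) (hK : IsCompact K) (hKD : K ⊆ D)
    (htop : firstEigenvalue α p D ≠ ∞)
    {g : EuclideanSpace ℝ (Fin n) → ℝ} (hg : Measurable g) {M : ℝ} (hM : ∀ x, |g x| ≤ M)
    (hgK : ∀ x ∉ K, g x = 0) :
    firstEigenvalue α p D * powIntegral p Set.univ g ≤ gagliardoEnergy p (α * p) Set.univ g := by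
  have hp0 : 0 < p := by linarith
  have hgi : LocallyIntegrable g volume := by
    refine Integrable.locallyIntegrable ?_
    rw [← integrableOn_iff_integrable_of_support_subset (s := K)
      fun x hx => by_contra fun h => hx (hgK x h)]
    exact Measure.integrableOn_of_bounded (M := M) hK.measure_lt_top.ne hg.aestronglyMeasurable
      (Eventually.of_forall hM)
  obtain ⟨δ, hδ, hδD⟩ := hK.exists_cthickening_subset_open hD hKD
  have hr : ∀ k : ℕ, 0 < δ / (k + 1 : ℝ) := fun k => by positivity
  let f : ℕ → ContDiffBump (0 : EuclideanSpace ℝ (Fin n)) := fun k =>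
    ⟨δ / (k + 1 : ℝ) / 2, δ / (k + 1 : ℝ), half_pos (hr k), half_lt_self (hr k)⟩
  have hfr : ∀ k, (f k).rOut = δ / (k + 1 : ℝ) := fun k => rfl
  have hlim : Tendsto (fun k => (f k).rOut) atTop (𝓝 0) := by
    simp only [hfr]
    have := (tendsto_one_div_add_atTop_nhds_zero_nat (𝕜 := ℝ)).const_mul δ
    simpa [div_eq_mul_inv] using this
  set h : ℕ → EuclideanSpace ℝ (Fin n) → ℝ := fun k =>
    convolution ((f k).normed volume) g (ContinuousLinearMap.lsmul ℝ ℝ) volume with hh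
  have htest : ∀ k, IsTestFunction D (h k) := fun k => by
    refine IsTestFunction.convolution_normed hK hgi hgK (f k)
      ((Metric.cthickening_mono ?_ K).trans hδD)
    rw [hfr]
    exact div_le_self hδ.le (by linarith [k.cast_nonneg (α := ℝ)])
  have hconv : ∀ᵐ x ∂(volume : Measure (EuclideanSpace ℝ (Fin n))),
      Tendsto (fun k => h k x) atTop (𝓝 (g x)) :=
    -- The ratio of outer to inner radius of the bumps is exactly 2.
    ContDiffBump.ae_convolution_tendsto_right_of_locallyIntegrable (K := 2) hlim
      (Eventually.of_forall fun k => by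
        show δ / (k + 1 : ℝ) ≤ 2 * (δ / (k + 1 : ℝ) / 2); linarith) hgi
  have hEk : ∀ k, firstEigenvalue α p D * powIntegral p Set.univ (h k) ≤
      gagliardoEnergy p (α * p) Set.univ g := fun k =>
    ((htest k).mul_powIntegral_le hp0).trans
      (gagliardoEnergy_convolution_le hp (f k).continuous_normed (f k).hasCompactSupport_normed
        (f k).nonneg_normed (lintegral_ofReal_normed _) hg hgi)
  have hfatou : powIntegral p Set.univ g ≤
      liminf (fun k => powIntegral p Set.univ (h k)) atTop := by
    unfold powIntegral
    simp only [Measure.restrict_univ]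
    refine le_trans (lintegral_mono_ae ?_) (lintegral_liminf_le' fun k => ?_)
    · filter_upwards [hconv] with x hx
      refine (Tendsto.liminf_eq ?_).ge
      exact ENNReal.tendsto_ofReal ((hx.abs).rpow_const (Or.inr hp0.le))
    · have := (htest k).1.continuous.measurable
      fun_prop
  calc _ ≤ firstEigenvalue α p D * liminf (fun k => powIntegral p Set.univ (h k)) atTop := by gcongr
    _ = liminf (fun k => firstEigenvalue α p D * powIntegral p Set.univ (h k)) atTop :=
        (ENNReal.liminf_const_mul_of_ne_top htop).symm
    _ ≤ _ := (liminf_le_liminf (Eventually.of_forall hEk)).trans_eq (liminf_const _)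

/-! ### Dominated approximation by test functions -/

/-- Summable errors yield at once almost everywhere convergence and a single integrable majorant:
the sum of all the errors' difference quotients. -/
lemma MemW0.exists_tsum_lt_top {s p : ℝ} {D : Set (EuclideanSpace ℝ (Fin n))}
    {u : EuclideanSpace ℝ (Fin n) → ℝ} (hu : MemW0 s p D u) :
    ∃ φ : ℕ → EuclideanSpace ℝ (Fin n) → ℝ, (∀ k, IsTestFunction D (φ k)) ∧
      ∑' k, sobolevNormPow s p D (fun x => φ k x - u x) < ∞ := by
  obtain ⟨-, -, -, φ, h1, h2⟩ := hu
  have h3 : ∀ j : ℕ, ∃ k, sobolevNormPow s p D (fun x => φ k x - u x) < 2⁻¹ ^ j := fun j =>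
    (h2.eventually_lt_const (ENNReal.pow_pos (by simp) j)).exists
  choose N hN using h3
  refine ⟨fun j => φ (N j), fun j => h1 _, ?_⟩
  refine (ENNReal.tsum_le_tsum fun j => (hN j).le).trans_lt ?_
  rw [ENNReal.tsum_geometric]
  simp

lemma diffQuot_le_of_sub {p β : ℝ} (hp : 1 ≤ p) (φ u : EuclideanSpace ℝ (Fin n) → ℝ)
    (z : EuclideanSpace ℝ (Fin n) × EuclideanSpace ℝ (Fin n)) :
    diffQuot p β φ z ≤
      2 ^ (p - 1) * (diffQuot p β (fun x => φ x - u x) z + diffQuot p β u z) := by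
  have hp0 : 0 ≤ p := by linarith
  unfold diffQuot
  rw [← add_mul, ← mul_assoc]
  gcongr
  simp only [ofReal_abs_rpow hp0]
  refine le_trans ?_ (ENNReal.rpow_add_le_mul_rpow_add_rpow _ _ hp)
  gcongr
  refine le_trans (le_of_eq ?_) (enorm_add_le _ _)
  congr 1
  ring

/-- Approximation of `u ∈ W_0^{s,p}(D)` by test functions that converge almost everywhere and
have dominated difference quotients. -/
lemma MemW0.exists_dominated_seq {α p : ℝ} (hp : 1 ≤ p)
    {D : Set (EuclideanSpace ℝ (Fin n))} (hD : MeasurableSet D)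
    {u : EuclideanSpace ℝ (Fin n) → ℝ} (hu : MemW0 (α - n / p) p D u) (hm : Measurable u)
    (h0 : ∀ x ∉ D, u x = 0) :
    ∃ φ : ℕ → EuclideanSpace ℝ (Fin n) → ℝ, (∀ k, IsTestFunction D (φ k)) ∧
      (∀ᵐ x ∂(volume : Measure (EuclideanSpace ℝ (Fin n))),
        Tendsto (fun k => φ k x) atTop (𝓝 (u x))) ∧
      ∃ S : EuclideanSpace ℝ (Fin n) × EuclideanSpace ℝ (Fin n) → ℝ≥0∞, Measurable S ∧
        ∫⁻ z in D ×ˢ D, S z ∂(volume.prod volume) ≠ ∞ ∧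
        ∀ k z, diffQuot p (α * p) (φ k) z ≤ S z := by
  have hp0 : 0 < p := by linarith
  obtain ⟨φ, hφ, hsum⟩ := hu.exists_tsum_lt_top
  -- The Sobolev seminorm and the Rayleigh quotient share the same kernel exponent.
  have hexp : (α - n / p) * p + n = α * p := by field_simp; ring
  have hmφ : ∀ k, Measurable fun x => φ k x - u x := fun k =>
    (hφ k).1.continuous.measurable.sub hm
  have hmP : ∀ k, Measurable fun x => ENNReal.ofReal (|φ k x - u x| ^ p) := fun k => by
    have := (hφ k).1.continuous.measurable
    fun_prop
  simp only [sobolevNormPow, hexp] at hsum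
  rw [ENNReal.tsum_add] at hsum
  have hsumE := (le_self_add.trans_lt hsum).ne
  have hsumP := (le_add_self.trans_lt hsum).ne
  simp only [gagliardoEnergy_eq_lintegral_prod D (hmφ _)] at hsumE
  unfold powIntegral at hsumP
  rw [← lintegral_tsum fun k => (measurable_diffQuot (hmφ k)).aemeasurable] at hsumE
  rw [← lintegral_tsum fun k => (hmP k).aemeasurable] at hsumP
  refine ⟨φ, hφ, ?_, fun z => 2 ^ (p - 1) *
    (∑' k, diffQuot p (α * p) (fun x => φ k x - u x) z + diffQuot p (α * p) u z), ?_, ?_, ?_⟩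
  · have hae : ∀ᵐ x ∂volume, x ∈ D → ∑' k, ENNReal.ofReal (|φ k x - u x| ^ p) < ∞ := by
      rw [← ae_restrict_iff' hD]
      exact ae_lt_top (Measurable.tsum hmP) hsumP
    filter_upwards [hae] with x hx
    by_cases hxD : x ∈ D
    · have h1 := ENNReal.tendsto_atTop_zero_of_tsum_ne_top (hx hxD).ne
      simp only [ofReal_abs_rpow hp0.le] at h1
      have h2 := h1.ennrpow_const p⁻¹
      simp only [← ENNReal.rpow_mul, mul_inv_cancel₀ hp0.ne', ENNReal.rpow_one,
        ENNReal.zero_rpow_of_pos (inv_pos.2 hp0)] at h2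
      exact tendsto_iff_enorm_sub_tendsto_zero.2 h2
    · have : ∀ k, φ k x = 0 := fun k =>
        image_eq_zero_of_notMem_tsupport fun h => hxD ((hφ k).2.2 h)
      simp [this, h0 x hxD]
  · exact ((Measurable.tsum fun k => measurable_diffQuot (hmφ k)).add
      (measurable_diffQuot hm)).const_mul _
  · have h2 : (2 : ℝ≥0∞) ^ (p - 1) ≠ ∞ := ENNReal.rpow_ne_top_of_nonneg (by linarith) (by simp)
    rw [lintegral_const_mul' _ _ h2, lintegral_add_right _ (measurable_diffQuot hm)]
    refine ENNReal.mul_ne_top h2 (ENNReal.add_ne_top.2 ⟨hsumE, ?_⟩)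
    rw [← gagliardoEnergy_eq_lintegral_prod D hm, ← hexp]
    exact (le_self_add.trans_lt hu.2.1).ne
  · intro k z
    refine (diffQuot_le_of_sub hp (φ k) u z).trans ?_
    beta_reduce
    gcongr
    exact ENNReal.le_tsum (f := fun k => diffQuot p (α * p) (fun x => φ k x - u x) z) k

/-! ### The Rayleigh inequality for the combined function -/

lemma diffQuot_pairNorm_le {p : ℝ} (hp : 1 < p) (β : ℝ) (u v : EuclideanSpace ℝ (Fin n) → ℝ)
    (z : EuclideanSpace ℝ (Fin n) × EuclideanSpace ℝ (Fin n)) :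
    diffQuot p β (fun x => pairNorm p (u x) (v x)) z ≤ diffQuot p β u z + diffQuot p β v z := by
  unfold diffQuot
  rw [← add_mul, ← ENNReal.ofReal_add (by positivity) (by positivity)]
  gcongr
  exact abs_pairNorm_sub_rpow_le hp _ _ _ _

/-- A difference of minima is at most the larger of the two differences, hence its p-th power is at
most the sum of theirs. -/
lemma diffQuot_min_le {p : ℝ} (hp : 0 < p) (β : ℝ) (u v : EuclideanSpace ℝ (Fin n) → ℝ)
    (z : EuclideanSpace ℝ (Fin n) × EuclideanSpace ℝ (Fin n)) :
    diffQuot p β (fun x => min (u x) (v x)) z ≤ diffQuot p β u z + diffQuot p β v z := by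
  unfold diffQuot
  rw [← add_mul, ← ENNReal.ofReal_add (by positivity) (by positivity)]
  gcongr
  refine (Real.rpow_le_rpow (abs_nonneg _) (abs_min_sub_min_le_max _ _ _ _) hp.le).trans ?_
  rcases max_choice |u z.2 - u z.1| |v z.2 - v z.1| with h | h <;> rw [h]
  · exact le_add_of_nonneg_right (by positivity)
  · exact le_add_of_nonneg_left (by positivity)

lemma tendsto_pairNorm {p : ℝ} (hp : 0 < p) {ι : Type*} {l : Filter ι} {f g : ι → ℝ} {a b : ℝ}
    (hf : Tendsto f l (𝓝 a)) (hg : Tendsto g l (𝓝 b)) :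
    Tendsto (fun k => pairNorm p (f k) (g k)) l (𝓝 (pairNorm p a b)) := by
  unfold pairNorm
  exact ((hf.abs.rpow_const (Or.inr hp.le)).add (hg.abs.rpow_const (Or.inr hp.le))).rpow_const
    (Or.inr (by positivity))

/-- The Rayleigh inequality for `(|u| ^ p + |v| ^ p) ^ (1 / p)`. -/
lemma mul_powIntegral_pairNorm_le {α p : ℝ} (hp : 1 < p)
    {D : Set (EuclideanSpace ℝ (Fin n))} (hD : IsOpen D)
    (htop : firstEigenvalue α p D ≠ ∞) {u v : EuclideanSpace ℝ (Fin n) → ℝ}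
    (hu : MemW0 (α - n / p) p D u) (hum : Measurable u) (hu0 : ∀ x ∉ D, u x = 0)
    (hv : MemW0 (α - n / p) p D v) (hvm : Measurable v) (hv0 : ∀ x ∉ D, v x = 0)
    (hEu : gagliardoEnergy p (α * p) Set.univ u ≠ ∞)
    (hEv : gagliardoEnergy p (α * p) Set.univ v ≠ ∞) :
    firstEigenvalue α p D * powIntegral p Set.univ (fun x => pairNorm p (u x) (v x)) ≤
      gagliardoEnergy p (α * p) Set.univ (fun x => pairNorm p (u x) (v x)) := by
  have hp0 : 0 < p := by linarith
  obtain ⟨φ, hφ, hφu, S, hSm, hS, hφS⟩ := hu.exists_dominated_seq hp.le hD.measurableSet hum hu0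
  obtain ⟨ψ, hψ, hψv, T, hTm, hT, hψT⟩ := hv.exists_dominated_seq hp.le hD.measurableSet hvm hv0
  have hN := continuous_pairNorm hp0
  set w : EuclideanSpace ℝ (Fin n) → ℝ := fun x => pairNorm p (u x) (v x) with hw
  set W : ℕ → EuclideanSpace ℝ (Fin n) → ℝ := fun k x => pairNorm p (φ k x) (ψ k x) with hW
  -- Truncating by `w` controls pairs outside `D ×ˢ D`; truncating by `W k` gives boundedness and
  -- compact support in `D`.
  set g : ℕ → EuclideanSpace ℝ (Fin n) → ℝ := fun k x => min (w x) (W k x) with hg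
  have hwm : Measurable w := hN.measurable.comp (hum.prodMk hvm)
  have hWc : ∀ k, Continuous (W k) := fun k =>
    hN.comp ((hφ k).1.continuous.prodMk (hψ k).1.continuous)
  have hgm : ∀ k, Measurable (g k) := fun k => hwm.min (hWc k).measurable
  have hw_nonneg : ∀ x, 0 ≤ w x := fun x => pairNorm_nonneg _ _ _
  have hW_nonneg : ∀ k x, 0 ≤ W k x := fun k x => pairNorm_nonneg _ _ _
  have hg_nonneg : ∀ k x, 0 ≤ g k x := fun k x => le_min (hw_nonneg x) (hW_nonneg k x)
  have hWK : ∀ k, ∀ x ∉ tsupport (φ k) ∪ tsupport (ψ k), W k x = 0 := fun k x hx => by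
    simp only [Set.mem_union, not_or] at hx
    simp only [hW, image_eq_zero_of_notMem_tsupport hx.1, image_eq_zero_of_notMem_tsupport hx.2,
      pairNorm_zero hp0]
  have hgK : ∀ k, ∀ x ∉ tsupport (φ k) ∪ tsupport (ψ k), g k x = 0 := fun k x hx => by
    simp only [hg, hWK k x hx, min_eq_right (hw_nonneg x)]
  have hKc : ∀ k, IsCompact (tsupport (φ k) ∪ tsupport (ψ k)) := fun k =>
    IsCompact.union (hφ k).2.1 (hψ k).2.1
  have hKD : ∀ k, tsupport (φ k) ∪ tsupport (ψ k) ⊆ D := fun k =>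
    Set.union_subset (hφ k).2.2 (hψ k).2.2
  have hw0 : ∀ x ∉ D, w x = 0 := fun x hx => by
    simp only [hw, hu0 x hx, hv0 x hx, pairNorm_zero hp0]
  have hg0 : ∀ k, ∀ x ∉ D, g k x = 0 := fun k x hx => hgK k x fun h => hx (hKD k h)
  have hgw : ∀ k x, g k x ≤ w x := fun k x => min_le_left _ _
  have hray : ∀ k, firstEigenvalue α p D * powIntegral p Set.univ (g k) ≤
      gagliardoEnergy p (α * p) Set.univ (g k) := fun k => by
    obtain ⟨M, hM⟩ := (hWc k).bounded_above_of_compact_support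
      (HasCompactSupport.intro (hKc k) (hWK k))
    refine mul_powIntegral_le_of_isCompact hp.le hD (hKc k) (hKD k) htop (hgm k) (M := M)
      (fun x => ?_) (hgK k)
    rw [abs_of_nonneg (hg_nonneg k x)]
    exact (min_le_right _ _).trans ((le_abs_self _).trans (hM x))
  have hlim : ∀ᵐ x ∂(volume : Measure (EuclideanSpace ℝ (Fin n))),
      Tendsto (fun k => g k x) atTop (𝓝 (w x)) := by
    filter_upwards [hφu, hψv] with x hx1 hx2
    have h1 : Tendsto (fun k => W k x) atTop (𝓝 (w x)) :=
      tendsto_pairNorm hp0 hx1 hx2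
    have h2 := (tendsto_const_nhds (x := w x) (f := (atTop : Filter ℕ))).min h1
    rwa [min_self] at h2
  have hE : Tendsto (fun k => gagliardoEnergy p (α * p) Set.univ (g k)) atTop
      (𝓝 (gagliardoEnergy p (α * p) Set.univ w)) := by
    simp only [gagliardoEnergy_univ_eq (hgm _), gagliardoEnergy_univ_eq hwm]
    refine tendsto_lintegral_of_dominated_convergence'
      (fun z => diffQuot p (α * p) u z + diffQuot p (α * p) v z
        + (D ×ˢ D).indicator (fun z => S z + T z) z)
      (fun k => (measurable_diffQuot (hgm k)).aemeasurable) (fun k => ?_) ?_ ?_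
    · refine Eventually.of_forall fun z => ?_
      have hwz := diffQuot_pairNorm_le hp (α * p) u v z
      beta_reduce
      by_cases hz : z ∈ D ×ˢ D
      · rw [Set.indicator_of_mem hz]
        refine (diffQuot_min_le hp0 _ w (W k) z).trans (add_le_add hwz ?_)
        exact (diffQuot_pairNorm_le hp (α * p) (φ k) (ψ k) z).trans
          (add_le_add (hφS k z) (hψT k z))
      -- One of the two points lies off `D`, where both `g k` and `w` vanish, so the differences
      -- reduce to values at the other point and 0 ≤ `g k` ≤ `w` suffices.
      · refine le_add_right (le_trans ?_ hwz)
        unfold diffQuot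
        gcongr 1
        refine ENNReal.ofReal_le_ofReal (Real.rpow_le_rpow (abs_nonneg _) ?_ hp0.le)
        change |g k z.2 - g k z.1| ≤ |w z.2 - w z.1|
        rw [Set.mem_prod, not_and_or] at hz
        rcases hz with hz | hz
        · rw [hg0 k _ hz, hw0 _ hz, sub_zero, sub_zero, abs_of_nonneg (hg_nonneg _ _),
            abs_of_nonneg (hw_nonneg _)]
          exact hgw _ _
        · rw [hg0 k _ hz, hw0 _ hz, zero_sub, zero_sub, abs_neg, abs_neg,
            abs_of_nonneg (hg_nonneg _ _), abs_of_nonneg (hw_nonneg _)]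
          exact hgw _ _
    · have hsm : Measurable fun z => diffQuot p (α * p) u z + diffQuot p (α * p) v z :=
        (measurable_diffQuot hum).add (measurable_diffQuot hvm)
      rw [lintegral_add_left hsm,
        lintegral_add_left (measurable_diffQuot hum), ← gagliardoEnergy_univ_eq hum,
        ← gagliardoEnergy_univ_eq hvm,
        lintegral_indicator (hD.measurableSet.prod hD.measurableSet), lintegral_add_left hSm]
      finiteness
    · have h1 := Measure.quasiMeasurePreserving_fst
        (μ := (volume : Measure (EuclideanSpace ℝ (Fin n))))
        (ν := (volume : Measure (EuclideanSpace ℝ (Fin n)))) |>.ae hlim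
      have h2 := Measure.quasiMeasurePreserving_snd
        (μ := (volume : Measure (EuclideanSpace ℝ (Fin n))))
        (ν := (volume : Measure (EuclideanSpace ℝ (Fin n)))) |>.ae hlim
      filter_upwards [h1, h2] with z hz1 hz2
      refine ENNReal.Tendsto.mul_const ?_ (Or.inr (kernel_ne_top _ _))
      exact ENNReal.tendsto_ofReal (((hz2.sub hz1).abs).rpow_const (Or.inr hp0.le))
  have hfatou : powIntegral p Set.univ w ≤
      liminf (fun k => powIntegral p Set.univ (g k)) atTop := by
    unfold powIntegral
    simp only [Measure.restrict_univ]
    refine le_trans (lintegral_mono_ae ?_) (lintegral_liminf_le' fun k => ?_)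
    · filter_upwards [hlim] with x hx
      refine (Tendsto.liminf_eq ?_).ge
      exact ENNReal.tendsto_ofReal ((hx.abs).rpow_const (Or.inr hp0.le))
    · have := hgm k
      fun_prop
  calc _ ≤ firstEigenvalue α p D * liminf (fun k => powIntegral p Set.univ (g k)) atTop := by gcongr
    _ = liminf (fun k => firstEigenvalue α p D * powIntegral p Set.univ (g k)) atTop :=
        (ENNReal.liminf_const_mul_of_ne_top htop).symm
    _ ≤ _ := (liminf_le_liminf (Eventually.of_forall hray)).trans_eq hE.liminf_eq

/-! ### The equality case and the conclusion -/

lemma powIntegral_pairNorm {p : ℝ} (hp : 0 < p) {D : Set (EuclideanSpace ℝ (Fin n))}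
    {u v : EuclideanSpace ℝ (Fin n) → ℝ} (hu : Measurable u) :
    powIntegral p D (fun x => pairNorm p (u x) (v x)) = powIntegral p D u + powIntegral p D v := by
  unfold powIntegral
  rw [← lintegral_add_left (by fun_prop)]
  refine lintegral_congr fun x => ?_
  rw [abs_of_nonneg (pairNorm_nonneg _ _ _), pairNorm_rpow hp,
    ENNReal.ofReal_add (by positivity) (by positivity)]

/-- Two functions are proportional as soon as the energy of `(|u| ^ p + |v| ^ p) ^ (1 / p)` is at
least the sum of their energies. -/
lemma exists_ae_eq_const_mul {p β : ℝ} (hp : 1 < p) {u v : EuclideanSpace ℝ (Fin n) → ℝ}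
    (hum : Measurable u) (hvm : Measurable v) (hu : ¬ u =ᵐ[volume] fun _ => 0)
    (hEu : gagliardoEnergy p β Set.univ u ≠ ∞) (hEv : gagliardoEnergy p β Set.univ v ≠ ∞)
    (h : gagliardoEnergy p β Set.univ u + gagliardoEnergy p β Set.univ v ≤
      gagliardoEnergy p β Set.univ fun x => pairNorm p (u x) (v x)) :
    ∃ c : ℝ, v =ᵐ[volume] fun x => c * u x := by
  have hp0 : 0 < p := by linarith
  have hwm : Measurable fun x => pairNorm p (u x) (v x) :=
    (continuous_pairNorm hp0).measurable.comp (hum.prodMk hvm)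
  have hsm : Measurable fun z => diffQuot p β u z + diffQuot p β v z :=
    (measurable_diffQuot hum).add (measurable_diffQuot hvm)
  have hle : ∀ z, diffQuot p β (fun x => pairNorm p (u x) (v x)) z ≤
      diffQuot p β u z + diffQuot p β v z := diffQuot_pairNorm_le hp β u v
  rw [gagliardoEnergy_univ_eq hum] at hEu h
  rw [gagliardoEnergy_univ_eq hvm] at hEv h
  rw [gagliardoEnergy_univ_eq hwm, ← lintegral_add_left (measurable_diffQuot hum)] at h
  have hfin : ∫⁻ z, diffQuot p β (fun x => pairNorm p (u x) (v x)) z ∂(volume.prod volume) ≠ ∞ := by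
    refine ((lintegral_mono hle).trans_lt ?_).ne
    rw [lintegral_add_left (measurable_diffQuot hum)]
    finiteness
  have hae := ae_eq_of_ae_le_of_lintegral_le (Eventually.of_forall hle) hfin hsm.aemeasurable h
  have hmul : ∀ᵐ z ∂((volume : Measure (EuclideanSpace ℝ (Fin n))).prod volume),
      u z.2 * v z.1 = u z.1 * v z.2 := by
    filter_upwards [hae] with z hz
    -- On the diagonal the identity is trivial; off it the kernel is positive and finite, so it
    -- cancels.
    rcases eq_or_ne z.2 z.1 with h1 | h1
    · rw [h1]
    have hk : kernel β (z.2 - z.1) ≠ 0 := by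
      have : 0 < ‖z.2 - z.1‖ := norm_pos_iff.2 (sub_ne_zero.2 h1)
      rw [kernel, Ne, ENNReal.ofReal_eq_zero, not_le]
      positivity
    unfold diffQuot at hz
    rw [← add_mul, ENNReal.mul_left_inj hk (kernel_ne_top _ _),
      ← ENNReal.ofReal_add (by positivity) (by positivity),
      ENNReal.ofReal_eq_ofReal_iff (by positivity) (by positivity)] at hz
    exact mul_eq_mul_of_abs_pairNorm_sub_rpow_eq hp hz
  have hfreq : ∃ᶠ x in ae (volume : Measure (EuclideanSpace ℝ (Fin n))), u x ≠ 0 := fun h => hu (by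
    filter_upwards [h] with x hx
    simpa using hx)
  -- By Fubini almost every x satisfies the relation for almost every y, and u(x) ≠ 0 on a non-null
  -- set.
  obtain ⟨x, hx, hxy⟩ := (hfreq.and_eventually (Measure.ae_ae_of_ae_prod hmul)).exists
  refine ⟨v x / u x, ?_⟩
  filter_upwards [hxy] with y hy
  field_simp
  linarith

end FractionalRayleigh

end

theorem mainTheorem7 (n : ℕ) (hn : 1 ≤ n) (α p : ℝ) (hp : 2 ≤ p)
    (hαp : 2 * (n : ℝ) < α * p) (hαp' : α * p < n + p)
    (Ω : Set (EuclideanSpace ℝ (Fin n))) (hΩ : IsOpen Ω) (hΩc : IsConnected Ω)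
    (hΩb : Bornology.IsBounded Ω)
    (u : EuclideanSpace ℝ (Fin n) → ℝ) (hu : FractionalRayleigh.IsMinimizer α p Ω u)
    (v : EuclideanSpace ℝ (Fin n) → ℝ) :
    FractionalRayleigh.IsMinimizer α p Ω v ↔
      ∃ c : ℝ, c ≠ 0 ∧ v =ᵐ[volume] fun x => c * u x := by
  have hp0 : 0 < p := by linarith
  have hp1 : 1 < p := by linarith
  refine ⟨fun hv => ?_, fun ⟨c, hc, h⟩ => (hu.const_mul hc).congr h.symm⟩
  have htop : FractionalRayleigh.firstEigenvalue α p Ω ≠ ∞ :=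
    (FractionalRayleigh.firstEigenvalue_lt_top hn hp0
      (by linarith [n.cast_nonneg (α := ℝ)]) hαp' hΩ hΩc.nonempty).ne
  obtain ⟨u', hum, hu0, huu, hu'⟩ := hu.exists_measurable hΩ.measurableSet
  obtain ⟨v', hvm, hv0, hvv, hv'⟩ := hv.exists_measurable hΩ.measurableSet
  have hEu := hu'.gagliardoEnergy_eq hp0 hΩ.measurableSet
  have hEv := hv'.gagliardoEnergy_eq hp0 hΩ.measurableSet
  have hEu_top := hEu ▸ ENNReal.mul_ne_top htop (hu'.1.powIntegral_ne_top hp0 hΩ.measurableSet)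
  have hEv_top := hEv ▸ ENNReal.mul_ne_top htop (hv'.1.powIntegral_ne_top hp0 hΩ.measurableSet)
  have hray := FractionalRayleigh.mul_powIntegral_pairNorm_le hp1 hΩ htop hu'.1 hum hu0
    hv'.1 hvm hv0 hEu_top hEv_top
  -- Since u' and v' are minimizers, λ₁ ∫ w^p is exactly the sum of their energies.
  rw [FractionalRayleigh.powIntegral_pairNorm hp0 hum, mul_add, ← hEu, ← hEv] at hray
  obtain ⟨c, hc⟩ := FractionalRayleigh.exists_ae_eq_const_mul hp1 hum hvm hu'.2.1
    hEu_top hEv_top hray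
  have hcv : v =ᵐ[volume] fun x => c * u x := by
    filter_upwards [huu, hvv, hc] with x h1 h2 h3
    rw [h1, h2, h3]
  refine ⟨c, ?_, hcv⟩
  rintro rfl
  exact hv.2.1 (by simpa using hcv)
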